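/- Let $K$ be an infinite field and $R=K[x_1,\dots,x_n]$ with $x_1<\dots<x_n$, $S=R[x_0]$ with $x_0<x_1$. A monomial ideal is strongly stable if in each of its terms any variable may be replaced by any larger one. For a monomial ideal $J$ let $\mathcal N(J)$ be the set of terms outside $J$ and $B_J$ its minimal monomial basis (for strongly stable $J$ this is its Pommaret basis $\mathcal P(J)$). Let $\mathfrak j\subseteq R$ be strongly stable, $m\ge 1$, and put $t_\alpha=\max\{m,|\alpha|\}$ for $x^\alpha\in B_{\mathfrak j}$. The ideal $\mathfrak j$ is an *affine $m$-segment* if there is $\omega\in\mathbb N^n$ such that $\deg_\omega(x^\alpha)>\deg_\omega(x^\gamma)$ for all $x^\alpha\in B_{\mathfrak j}$ and all $x^\gamma\in\mathcal N(\mathfrak j)$ with $|\gamma|\le t_\alpha$. For a commutative ring $A$ and a strongly stable ideal $J\subseteq S$, a *$\mathcal P(J)$-marked basis* over $A$ is a family of homogeneous polynomials $F_\beta\in A[x_0,\dots,x_n]$, $x^\beta\in B_J$, such that $F_\beta-x^\beta$ is an $A$-combination of terms of $\mathcal N(J)$ and $A[x_0,\dots,x_n]=(F_\beta)_\beta\oplus\langle\mathcal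 N(J)\rangle_A$. A *$[\mathcal P(\mathfrak j),m]$-marked basis* over $A$ is a family $f_\alpha\in A[x_1,\dots,x_n]$, $x^\alpha\in B_{\mathfrak j}$, such that $f_\alpha-x^\alpha$ is an $A$-combination of terms $x^\gamma\in\mathcal N(\mathfrak j)$ with $|\gamma|\le t_\alpha$, and such that, with $J=\mathfrak j\cdot S$, there is a $\mathcal P(J_{\ge m})$-marked basis over $A$ that contains $x_0^{k_\alpha}f_\alpha^h$ for every $\alpha$ and a suitable integer $k_\alpha\ge 0$, where $f^h$ is the homogenization of $f$ by $x_0$. The *marked scheme* $\mathrm{Mf}_{\mathcal P(\mathfrak j),m}$ is $\mathrm{Spec}(K[C]/\mathfrak U)$, where $C=\{C_{\alpha\gamma}: x^\alpha\in B_{\mathfrak j},\ x^\gamma\in\mathcal N(\mathfrak j),\ |\gamma|\le t_\alpha\}$ is the set of possible coefficients and $\mathfrak U$ is the ideal of the relations between the coefficients of $[\mathcal P(\mathfrak j),m]$-marked bases, i.e. the smallest ideal of $K[C]$ modulo which the polynomials $x^\alpha+\sum_\gamma C_{\alpha\gamma}x^\gamma$ form a $[\mathcal P(\mathfrak j),m]$-marked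 basis. The ideal $\mathfrak j$ corresponds to the $K$-point at which all $C_{\alpha\gamma}$ vanish. **Theorem.** Let $\mathfrak j\subseteq R$ be a strongly stable ideal that is an affine $m$-segment. Then every irreducible component $\mathcal M$ of $\mathrm{Mf}_{\mathcal P(\mathfrak j),m}$ contains the point $\mathfrak j$, and $\mathrm{Mf}_{\mathcal P(\mathfrak j),m}$ is connected. If moreover the point $\mathfrak j$ is smooth on $\mathcal M$ (with its reduced scheme structure, over $K$), then $\mathcal M$ is isomorphic over $K$ to an affine space $\mathbb A^d_K$ for some $d\ge 0$. -/

import Mathlib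

universe u v

open AlgebraicGeometry CategoryTheory

namespace Marked

noncomputable section

section Monomials

variable {σ : Type*} {K : Type*} [Field K]

/-- The exponents of the terms (monic monomials) lying in the ideal `J`. -/
def terms (J : Ideal (MvPolynomial σ K)) : Set (σ →₀ ℕ) :=
  {α | MvPolynomial.monomial α (1 : K) ∈ J}

/-- `𝒩(J)`: the exponents of the terms outside `J`. -/
def sousEscalier (J : Ideal (MvPolynomial σ K)) : Set (σ →₀ ℕ) :=
  (terms J)ᶜ

/-- `B_J`: the exponents of the minimal monomial generators of a monomial ideal `J`, that is the
terms of `J` that are minimal for divisibility. -/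
def minGens (J : Ideal (MvPolynomial σ K)) : Set (σ →₀ ℕ) :=
  {α | Minimal (· ∈ terms J) α}

/-- A strongly stable ideal: a monomial ideal such that in each of its terms any variable may be
replaced by any larger variable (variables are ordered as their indices). For such an ideal the
Pommaret basis `𝒫(J)` is the minimal monomial basis `B_J`. -/
def IsStronglyStable [LinearOrder σ] (J : Ideal (MvPolynomial σ K)) : Prop :=
  J = Ideal.span ((fun α => MvPolynomial.monomial α (1 : K)) '' terms J) ∧
    ∀ α : σ →₀ ℕ, ∀ i k : σ, i < k →
      α + Finsupp.single i 1 ∈ terms J → α + Finsupp.single k 1 ∈ terms J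

/-- The truncation `J_{≥ m}`: the elements of `J` all of whose terms have degree at least `m`. -/
def truncation (J : Ideal (MvPolynomial σ K)) (m : ℕ) : Ideal (MvPolynomial σ K) :=
  J ⊓ MvPolynomial.idealOfVars σ K ^ m

end Monomials

section Homogeneous

variable {σ : Type*} {K : Type*} [Field K] {A : Type*} [CommRing A]

/-- A `𝒫(J)`-marked set with coefficients in `A`: homogeneous polynomials `G α`, one for each
`α ∈ B_J`, with monic head term `x^α` and all the other terms outside `J`. -/
structure IsHomogeneousMarkedSet (J : Ideal (MvPolynomial σ K))
    (G : minGens J → MvPolynomial σ A) : Prop where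
  isHomogeneous : ∀ α, (G α).IsHomogeneous (Finsupp.degree α.1)
  coeff_head : ∀ α, (G α).coeff α.1 = 1
  tail : ∀ α, ∀ γ ∈ (G α).support, γ ≠ α.1 → γ ∈ sousEscalier J

/-- A `𝒫(J)`-marked basis with coefficients in `A`: a `𝒫(J)`-marked set `G` such that
`A[x] = (G) ⊕ ⟨𝒩(J)⟩` as `A`-modules. -/
structure IsHomogeneousMarkedBasis (J : Ideal (MvPolynomial σ K))
    (G : minGens J → MvPolynomial σ A) : Prop extends IsHomogeneousMarkedSet J G where
  isCompl : IsCompl ((Ideal.span (Set.range G)).restrictScalars A)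
    (Submodule.span A
      ((fun γ => MvPolynomial.monomial γ (1 : A)) '' sousEscalier J))

end Homogeneous

section Affine

variable {n : ℕ}

/-- The homogenization `f^h = x₀ ^ deg f * f (x₁ / x₀, …, xₙ / x₀)`. The variables `x₁ < … < xₙ`
are indexed by `Fin n`; in `n + 1` variables the index `0` is that of the new smallest variable
`x₀`, and the other variables are shifted by `Fin.succ`. -/
def homogenization {A : Type*} [CommRing A] (f : MvPolynomial (Fin n) A) :
    MvPolynomial (Fin (n + 1)) A :=
  ∑ γ ∈ f.support, MvPolynomial.monomial
    (Finsupp.single 0 (f.totalDegree - Finsupp.degree γ) + Finsupp.mapDomain Fin.succ γ)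
    (f.coeff γ)

variable {K : Type u} [Field K]

/-- The extension `J = 𝔧 · S` of `𝔧 ⊆ R = K[x₁, …, xₙ]` to `S = R[x₀]`. -/
def extend (j : Ideal (MvPolynomial (Fin n) K)) : Ideal (MvPolynomial (Fin (n + 1)) K) :=
  j.map (MvPolynomial.rename Fin.succ : MvPolynomial (Fin n) K →ₐ[K] _)

/-- A `[𝒫(𝔧), m]`-marked set with coefficients in `A`: polynomials `f α`, one for each `α ∈ B_𝔧`,
with monic head term `x^α` and all the other terms in `𝒩(𝔧)_{≤ t}`, `t = max {m, |α|}`. -/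
structure IsMarkedSet (j : Ideal (MvPolynomial (Fin n) K)) (m : ℕ) {A : Type*} [CommRing A]
    (f : minGens j → MvPolynomial (Fin n) A) : Prop where
  coeff_head : ∀ α, (f α).coeff α.1 = 1
  tail : ∀ α, ∀ γ ∈ (f α).support, γ ≠ α.1 →
    γ ∈ sousEscalier j ∧ Finsupp.degree γ ≤ max m (Finsupp.degree α.1)

/-- A `[𝒫(𝔧), m]`-marked basis with coefficients in `A`: a `[𝒫(𝔧), m]`-marked set `f` such that
for a suitable `𝒫((𝔧 · S)_{≥ m})`-marked basis `G` each `f α` has a multiple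
`x₀ ^ k * (f α)^h` in `G`. -/
structure IsMarkedBasis (j : Ideal (MvPolynomial (Fin n) K)) (m : ℕ) {A : Type*} [CommRing A]
    (f : minGens j → MvPolynomial (Fin n) A) : Prop extends IsMarkedSet j m f where
  exists_homogeneous : ∃ G : minGens (truncation (extend j) m) → MvPolynomial (Fin (n + 1)) A,
    IsHomogeneousMarkedBasis (truncation (extend j) m) G ∧
      ∀ α, ∃ k : ℕ, ∃ β, MvPolynomial.X 0 ^ k * homogenization (f α) = G β

/-- The set `𝒩(𝔧)_{≤ t}`. -/
def sousEscalierLE (j : Ideal (MvPolynomial (Fin n) K)) (t : ℕ) : Set (Fin n →₀ ℕ) :=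
  {γ | γ ∈ sousEscalier j ∧ Finsupp.degree γ ≤ t}

instance (j : Ideal (MvPolynomial (Fin n) K)) (t : ℕ) : Fintype (sousEscalierLE j t) :=
  Set.Finite.fintype ((Finsupp.finite_of_degree_le t).subset fun _ h => h.2)

/-- The set of parameters `C`: one for each `α ∈ B_𝔧` and each `γ ∈ 𝒩(𝔧)_{≤ t}`,
`t = max {m, |α|}`. -/
abbrev Param (j : Ideal (MvPolynomial (Fin n) K)) (m : ℕ) : Type :=
  Σ α : minGens j, sousEscalierLE j (max m (Finsupp.degree α.1))

/-- The `[𝒫(𝔧), m]`-marked set with coefficients `c`: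
`f α = x^α + ∑ c (α, γ) x^γ`, the sum being over `γ ∈ 𝒩(𝔧)_{≤ t}`. -/
def markedSet (j : Ideal (MvPolynomial (Fin n) K)) (m : ℕ) {A : Type*} [CommRing A]
    (c : Param j m → A) (α : minGens j) : MvPolynomial (Fin n) A :=
  MvPolynomial.monomial α.1 1 +
    ∑ γ : sousEscalierLE j (max m (Finsupp.degree α.1)),
      MvPolynomial.monomial γ.1 (c ⟨α, γ⟩)

/-- The ideal `𝔘 ⊆ K[C]` of the relations satisfied by the coefficients of the
`[𝒫(𝔧), m]`-marked bases: the smallest ideal modulo which the marked set whose coefficients are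
the parameters themselves is a marked basis. -/
def relations (j : Ideal (MvPolynomial (Fin n) K)) (m : ℕ) :
    Ideal (MvPolynomial (Param j m) K) :=
  sInf {𝔞 | IsMarkedBasis j m
    (markedSet j m fun p => Ideal.Quotient.mk 𝔞 (MvPolynomial.X p))}

/-- The coordinate ring `K[C] / 𝔘` of the marked scheme. -/
abbrev CoordRing (j : Ideal (MvPolynomial (Fin n) K)) (m : ℕ) : Type u :=
  MvPolynomial (Param j m) K ⧸ relations j m

/-- The marked scheme `Mf_{𝒫(𝔧), m} = Spec (K[C] / 𝔘)`. -/
abbrev markedScheme (j : Ideal (MvPolynomial (Fin n) K)) (m : ℕ) : Scheme.{u} :=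
  Spec (CommRingCat.of (CoordRing j m))

/-- `𝔧` is an affine `m`-segment. -/
def IsAffineSegment (j : Ideal (MvPolynomial (Fin n) K)) (m : ℕ) : Prop :=
  IsStronglyStable j ∧ 0 < m ∧ ∃ ω : Fin n → ℕ, ∀ α ∈ minGens j, ∀ γ ∈ sousEscalier j,
    Finsupp.degree γ ≤ max m (Finsupp.degree α) → Finsupp.weight ω γ < Finsupp.weight ω α

end Affine

section Vertex

/-! The terms `x^α`, `α ∈ B_𝔧`, form a `[𝒫(𝔧), m]`-marked basis, hence the origin of the
parameter space lies on the marked scheme. -/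

variable {σ : Type*} {K : Type u} [Field K]

theorem terms_upper {J : Ideal (MvPolynomial σ K)} {α β : σ →₀ ℕ} (h : α ∈ terms J)
    (hle : α ≤ β) : β ∈ terms J := by
  obtain ⟨δ, rfl⟩ := exists_add_of_le hle
  have := J.mul_mem_left (MvPolynomial.monomial δ (1 : K)) h
  rw [MvPolynomial.monomial_mul, one_mul, add_comm] at this
  exact this

theorem exists_minGens_le [Finite σ] {J : Ideal (MvPolynomial σ K)} {α : σ →₀ ℕ}
    (h : α ∈ terms J) : ∃ β ∈ minGens J, β ≤ α := by
  obtain ⟨β, hle, hβ⟩ := exists_minimal_le_of_wellFoundedLT (· ∈ terms J) α h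
  exact ⟨β, hβ, hle⟩

theorem monomials_isHomogeneousMarkedBasis [Finite σ] (J : Ideal (MvPolynomial σ K))
    {A : Type*} [CommRing A] :
    IsHomogeneousMarkedBasis J fun α => MvPolynomial.monomial α.1 (1 : A) where
  isHomogeneous α := MvPolynomial.isHomogeneous_monomial _ rfl
  coeff_head α := by
    classical
    exact (MvPolynomial.coeff_monomial _ _ _).trans (if_pos rfl)
  tail α γ h hne := by
    classical
    exact absurd (by simpa using MvPolynomial.support_monomial_subset h) hne
  isCompl := by
    have hr : (Set.range fun α : minGens J => MvPolynomial.monomial α.1 (1 : A)) =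
        (fun α => MvPolynomial.monomial α (1 : A)) '' minGens J := by
      ext x
      exact ⟨fun ⟨α, h⟩ => ⟨α.1, α.2, h⟩, fun ⟨α, hα, h⟩ => ⟨⟨α, hα⟩, h⟩⟩
    have hspan : Submodule.span A ((fun γ => MvPolynomial.monomial γ (1 : A)) '' sousEscalier J)
        = MvPolynomial.restrictSupport A (sousEscalier J) := by
      rw [MvPolynomial.restrictSupport_eq_span]
    rw [hr, hspan]
    constructor
    · rw [Submodule.disjoint_def]
      intro x hx hx'
      rw [Submodule.restrictScalars_mem, MvPolynomial.mem_ideal_span_monomial_image] at hx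
      rw [MvPolynomial.mem_restrictSupport_iff] at hx'
      rw [← MvPolynomial.support_eq_empty, Finset.eq_empty_iff_forall_notMem]
      intro γ hγ
      obtain ⟨α, hα, hle⟩ := hx γ hγ
      exact hx' hγ (terms_upper hα.prop hle)
    · rw [codisjoint_iff, eq_top_iff]
      intro x _
      rw [x.as_sum]
      refine Submodule.sum_mem _ fun γ hγ => ?_
      by_cases h : γ ∈ terms J
      · obtain ⟨β, hβ, hle⟩ := exists_minGens_le h
        refine Submodule.mem_sup_left ?_
        rw [Submodule.restrictScalars_mem, MvPolynomial.mem_ideal_span_monomial_image]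
        intro δ hδ
        have := MvPolynomial.support_monomial_subset hδ
        simp only [Finset.mem_singleton] at this
        exact ⟨β, hβ, this ▸ hle⟩
      · refine Submodule.mem_sup_right ?_
        rw [MvPolynomial.mem_restrictSupport_iff]
        intro δ hδ
        have := MvPolynomial.support_monomial_subset hδ
        simp only [Finset.mem_singleton] at this
        exact this ▸ h

variable {n : ℕ}

theorem mem_terms_extend (j : Ideal (MvPolynomial (Fin n) K)) (a : ℕ) (α : Fin n →₀ ℕ) :
    Finsupp.single 0 a + Finsupp.mapDomain Fin.succ α ∈ terms (extend j) ↔ α ∈ terms j := by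
  constructor
  · intro h
    let φ : MvPolynomial (Fin (n + 1)) K →ₐ[K] MvPolynomial (Fin n) K :=
      MvPolynomial.aeval (Fin.cons 1 MvPolynomial.X)
    have hφ : ∀ f, φ (MvPolynomial.rename Fin.succ f) = f := by
      intro f
      simp only [φ, MvPolynomial.aeval_rename]
      have : (Fin.cons 1 MvPolynomial.X : Fin (n + 1) → MvPolynomial (Fin n) K) ∘ Fin.succ
          = MvPolynomial.X := by
        ext1 i; simp
      rw [this, MvPolynomial.aeval_X_left_apply]
    have hle : extend j ≤ j.comap φ := by
      rw [extend, Ideal.map_le_iff_le_comap]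
      intro f hf
      rw [Ideal.mem_comap, Ideal.mem_comap]
      have := hφ f
      simp only [this]
      exact hf
    have h1 := hle h
    rw [Ideal.mem_comap] at h1
    have h3 : MvPolynomial.monomial (Finsupp.single 0 a + Finsupp.mapDomain Fin.succ α) (1 : K) =
        MvPolynomial.X 0 ^ a * MvPolynomial.rename Fin.succ (MvPolynomial.monomial α 1) := by
      rw [MvPolynomial.rename_monomial, MvPolynomial.X_pow_eq_monomial,
        MvPolynomial.monomial_mul, one_mul]
    rw [h3, map_mul, hφ, map_pow] at h1
    simpa [φ, terms] using h1
  · intro h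
    have := (extend j).mul_mem_left (MvPolynomial.X 0 ^ a)
      (Ideal.mem_map_of_mem (MvPolynomial.rename Fin.succ) h)
    rw [MvPolynomial.rename_monomial, MvPolynomial.X_pow_eq_monomial,
        MvPolynomial.monomial_mul, one_mul] at this
    exact this

theorem mem_terms_truncation (J : Ideal (MvPolynomial σ K)) (m : ℕ) (α : σ →₀ ℕ) :
    α ∈ terms (truncation J m) ↔ α ∈ terms J ∧ m ≤ Finsupp.degree α := by
  classical
  simp only [terms, truncation, Set.mem_ofPred_eq, Submodule.mem_inf,
    MvPolynomial.mem_pow_idealOfVars_iff]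
  refine and_congr_right fun _ => ?_
  simp [MvPolynomial.support_monomial]

theorem degree_extend (a : ℕ) (α : Fin n →₀ ℕ) :
    Finsupp.degree (Finsupp.single 0 a + Finsupp.mapDomain Fin.succ α) =
      a + Finsupp.degree α := by
  rw [map_add, Finsupp.degree_single, Finsupp.degree_mapDomain]

theorem exists_eq_extend (δ : Fin (n + 1) →₀ ℕ) :
    ∃ a α, δ = Finsupp.single 0 a + Finsupp.mapDomain Fin.succ α := by
  refine ⟨δ 0, δ.tail, ?_⟩
  ext i
  refine Fin.cases ?_ (fun i => ?_) i
  · rw [Finsupp.add_apply, Finsupp.mapDomain_of_notMem_range]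
    · simp
    · simp
  · rw [Finsupp.add_apply, Finsupp.mapDomain_apply (Fin.succ_injective n)]
    simp [Finsupp.tail_apply]

theorem extend_mem_minGens (j : Ideal (MvPolynomial (Fin n) K)) (m : ℕ) {α : Fin n →₀ ℕ}
    (h : α ∈ minGens j) :
    Finsupp.single 0 (m - Finsupp.degree α) + Finsupp.mapDomain Fin.succ α ∈
      minGens (truncation (extend j) m) := by
  constructor
  · show _ ∈ terms _
    rw [mem_terms_truncation, mem_terms_extend, degree_extend]
    exact ⟨h.prop, by omega⟩
  · intro δ hδ hle
    obtain ⟨a, β, rfl⟩ := exists_eq_extend δ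
    change _ ∈ terms _ at hδ
    rw [mem_terms_truncation, mem_terms_extend, degree_extend] at hδ
    have h0 : ∀ (a : ℕ) (α : Fin n →₀ ℕ),
        (Finsupp.single 0 a + Finsupp.mapDomain Fin.succ α : Fin (n + 1) →₀ ℕ) 0 = a := by
      intro a α
      rw [Finsupp.add_apply, Finsupp.mapDomain_of_notMem_range] <;> simp
    have hs : ∀ (a : ℕ) (α : Fin n →₀ ℕ) (i : Fin n),
        (Finsupp.single 0 a + Finsupp.mapDomain Fin.succ α : Fin (n + 1) →₀ ℕ) i.succ = α i := by
      intro a α i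
      rw [Finsupp.add_apply, Finsupp.mapDomain_apply (Fin.succ_injective n)]
      simp
    have hβα : β ≤ α := fun i => by simpa only [hs] using hle i.succ
    have hβ : β = α := le_antisymm hβα (h.2 hδ.1 hβα)
    have ha : a ≤ m - Finsupp.degree α := by simpa only [h0] using hle 0
    subst hβ
    have : a = m - Finsupp.degree β := by omega
    rw [this]

theorem monomials_isMarkedBasis (j : Ideal (MvPolynomial (Fin n) K)) (m : ℕ)
    {A : Type*} [CommRing A] [Nontrivial A] :
    IsMarkedBasis j m fun α => MvPolynomial.monomial α.1 (1 : A) where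
  coeff_head α := by
    classical
    exact (MvPolynomial.coeff_monomial _ _ _).trans (if_pos rfl)
  tail α γ h hne := by
    classical
    exact absurd (by simpa using MvPolynomial.support_monomial_subset h) hne
  exists_homogeneous := by
    classical
    refine ⟨_, monomials_isHomogeneousMarkedBasis _, fun α =>
      ⟨m - Finsupp.degree α.1, ⟨_, extend_mem_minGens j m α.2⟩, ?_⟩⟩
    rw [homogenization, MvPolynomial.support_monomial, if_neg one_ne_zero, Finset.sum_singleton,
      MvPolynomial.totalDegree_monomial _ one_ne_zero, MvPolynomial.X_pow_eq_monomial,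
      MvPolynomial.monomial_mul]
    simp [Finsupp.degree_eq_sum, Finsupp.sum_fintype]

/-- The coordinates vanish at the origin, and the origin satisfies the relations. -/
theorem relations_le_ker (j : Ideal (MvPolynomial (Fin n) K)) (m : ℕ) :
    relations j m ≤
    RingHom.ker (MvPolynomial.aeval (0 : Param j m → K) : MvPolynomial (Param j m) K →ₐ[K] K) := by
  refine sInf_le ?_
  set I := RingHom.ker
    (MvPolynomial.aeval (0 : Param j m → K) : MvPolynomial (Param j m) K →ₐ[K] K) with hI
  have : I.IsPrime := RingHom.ker_isPrime _
  have : Nontrivial (MvPolynomial (Param j m) K ⧸ I) :=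
    Ideal.Quotient.nontrivial_iff.mpr this.ne_top
  have h0 : (fun p => Ideal.Quotient.mk I (MvPolynomial.X p)) = 0 := by
    ext1 p
    exact Ideal.Quotient.eq_zero_iff_mem.mpr (by simp [hI, RingHom.mem_ker])
  have h1 : markedSet j m (fun p => Ideal.Quotient.mk I (MvPolynomial.X p)) =
      fun α => MvPolynomial.monomial α.1 1 := by
    ext1 α
    rw [h0]
    simp [markedSet]
  rw [Set.mem_ofPred_eq, h1]
  exact monomials_isMarkedBasis j m

/-- The `K`-algebra homomorphism `K[C] / 𝔘 → K` with all parameters mapped to `0`. It is the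
`K`-point of the marked scheme whose marked basis is that of the terms `x^α`, `α ∈ B_𝔧`. -/
def vertexHom (j : Ideal (MvPolynomial (Fin n) K)) (m : ℕ) : CoordRing j m →ₐ[K] K :=
  Ideal.Quotient.liftₐ (relations j m) (MvPolynomial.aeval (0 : Param j m → K))
    fun _ h => relations_le_ker j m h

/-- The point of the marked scheme corresponding to the ideal `𝔧`. -/
def vertex (j : Ideal (MvPolynomial (Fin n) K)) (m : ℕ) : markedScheme j m :=
  (⟨RingHom.ker (vertexHom j m), RingHom.ker_isPrime _⟩ : PrimeSpectrum (CoordRing j m))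

end Vertex

section Component

variable {n : ℕ} {K : Type u} [Field K]

/-- The coordinate ring of the reduced closed subscheme of the marked scheme supported on the
closed set `Z`. -/
abbrev ReducedCoordRing (j : Ideal (MvPolynomial (Fin n) K)) (m : ℕ) (Z : Set (markedScheme j m)) :
    Type u :=
  CoordRing j m ⧸ PrimeSpectrum.vanishingIdeal (R := CoordRing j m) Z

/-- The closed set `Z` as a reduced closed subscheme of the marked scheme. -/
abbrev reducedSubscheme (j : Ideal (MvPolynomial (Fin n) K)) (m : ℕ) (Z : Set (markedScheme j m)) :
    Scheme.{u} :=
  Spec (CommRingCat.of (ReducedCoordRing j m Z))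

/-- The structure morphism of `reducedSubscheme` over `Spec K`. -/
abbrev structureMorphism (j : Ideal (MvPolynomial (Fin n) K)) (m : ℕ)
    (Z : Set (markedScheme j m)) : reducedSubscheme j m Z ⟶ Spec (CommRingCat.of K) :=
  Spec.map (CommRingCat.ofHom (algebraMap K (ReducedCoordRing j m Z)))

/-- The point corresponding to `𝔧` is a point of the reduced closed subscheme supported on `Z`, and
this subscheme is smooth over `K` at this point. -/
def IsSmoothAtVertex (j : Ideal (MvPolynomial (Fin n) K)) (m : ℕ)
    (Z : Set (markedScheme j m)) : Prop :=
  ∃ o : PrimeSpectrum (ReducedCoordRing j m Z),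
    PrimeSpectrum.comap (Ideal.Quotient.mk _) o = vertex j m ∧
      o ∈ Algebra.smoothLocus K (ReducedCoordRing j m Z)

end Component

end

end Marked

/-!
The marked scheme of an affine segment is a cone with vertex `𝔧` with respect to an action of the
multiplicative group that contracts the parameter space to the origin; both assertions follow from
this.

*The action.* Let `ω` be a weight vector that makes `𝔧` an affine segment. Substituting
`c ^ ω i * x i` for `x i` and making the head terms monic again maps marked bases to marked bases
(`IsMarkedBasis.torusAction`), since it preserves supports and commutes with homogenization if `x₀`
is given weight `0`. On parameters it multiplies `C (α, γ)` by a power of `c` whose exponent is, up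
to sign, the difference of the `ω`-degrees of `x^α` and `x^γ`. Hence the set of ideals whose
infimum is `relations j m` is stable under the torus, and so is `relations j m` itself
(`torusAction_mem_relations`); no property of that infimum beyond its definition is needed. As `K`
is infinite, `relations j m` is homogeneous for the grading of `K[C]` by these differences
(`isWeightedHomogeneousIdeal_of_torusAction_mem`), which are positive by the segment condition.

*Components.* The minimal primes over a homogeneous ideal are homogeneous, and a proper homogeneous
ideal for a positive grading consists of polynomials without constant term. So all irreducible
components pass through the vertex, and the scheme is connected.

*Smooth components.* Let `B` be the coordinate ring of a component. By the graded Nakayama lemma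
(`surjective_of_span_cotangent`), those parameters that form a basis of the cotangent space of `B`
at the vertex generate `B`, and the relations between them have no linear terms. If `B` is smooth at
the vertex, there are no such relations (`injective_of_isSmoothAt_of_ker_le`): by infinitesimal
lifting they lie in all powers of the ideal of the variables. So `B` is a polynomial ring.
-/

namespace Marked

open MvPolynomial

/-! ### Weighted homogeneous ideals and torus actions -/

section WeightedHomogeneous

variable {σ : Type*} {K : Type*} [Field K]

/-- An ideal of a polynomial ring that is homogeneous for the grading in which the variable `i` has
degree `w i`, in elementary form: it contains the components of each of its elements. -/
def IsWeightedHomogeneousIdeal (w : σ → ℕ) (I : Ideal (MvPolynomial σ K)) : Prop :=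
  ∀ f ∈ I, ∀ d, weightedHomogeneousComponent w d f ∈ I

theorem isWeightedHomogeneousIdeal_iff (w : σ → ℕ) (I : Ideal (MvPolynomial σ K)) :
    letI := weightedGradedAlgebra K w
    IsWeightedHomogeneousIdeal w I ↔ I.IsHomogeneous (weightedHomogeneousSubmodule K w) := by
  let := weightedGradedAlgebra K w
  refine ⟨fun h d f hf => ?_, fun h f hf d => weightedHomogeneousComponent_mem_of_mem K w h hf d⟩
  have := h f hf d
  rwa [← weightedDecomposition.decompose'_apply] at this

/-- The action on polynomials of the element `c` of the one-dimensional torus that has weight `w i`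
on the variable `i`, combined with a change `e` of the coefficient ring. -/
noncomputable def torusAction {A A' : Type*} [CommRing A] [CommRing A'] (e : A →+* A') (w : σ → ℕ)
    (c : A') : MvPolynomial σ A →+* MvPolynomial σ A' :=
  eval₂Hom (C.comp e) fun i => C (c ^ w i) * X i

section

variable {A A' : Type*} [CommRing A] [CommRing A'] (e : A →+* A') (w : σ → ℕ) (c : A')

theorem torusAction_monomial (d : σ →₀ ℕ) (r : A) :
    torusAction e w c (monomial d r) = monomial d (c ^ Finsupp.weight w d * e r) := by
  rw [torusAction, coe_eval₂Hom, eval₂_monomial, Finsupp.weight_apply, monomial_eq, Finsupp.sum,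
    ← Finset.prod_pow_eq_pow_sum, map_mul C, map_prod C, Finsupp.prod, Finsupp.prod,
    RingHom.comp_apply]
  simp only [mul_pow, Finset.prod_mul_distrib, ← map_pow, ← pow_mul, smul_eq_mul]
  simp only [mul_comm (w _)]
  ring

theorem coeff_torusAction (f : MvPolynomial σ A) (d : σ →₀ ℕ) :
    (torusAction e w c f).coeff d = c ^ Finsupp.weight w d * e (f.coeff d) := by
  classical
  induction f using MvPolynomial.induction_on' with
  | monomial d' r =>
    rw [torusAction_monomial, coeff_monomial, coeff_monomial]
    split_ifs with h
    · rw [h]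
    · rw [map_zero, mul_zero]
  | add p q hp hq => rw [map_add, coeff_add, hp, hq, coeff_add, map_add, mul_add]

end

theorem torusAction_weightedHomogeneousComponent (w : σ → ℕ) (c : K) (d : ℕ)
    (f : MvPolynomial σ K) :
    torusAction (RingHom.id K) w c (weightedHomogeneousComponent w d f) =
      c ^ d • weightedHomogeneousComponent w d f := by
  classical
  rw [weightedHomogeneousComponent_apply, map_sum, Finset.smul_sum]
  refine Finset.sum_congr rfl fun e he => ?_
  rw [torusAction_monomial, (Finset.mem_filter.mp he).2, smul_monomial, smul_eq_mul,
    RingHom.id_apply]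

/-- Over an infinite field, an ideal that is stable under the torus is weighted homogeneous: modulo
the ideal the components of an element are the coefficients of a polynomial function of the torus
parameter that vanishes identically. -/
theorem isWeightedHomogeneousIdeal_of_torusAction_mem [Infinite K] (w : σ → ℕ)
    (I : Ideal (MvPolynomial σ K))
    (h : ∀ c : K, c ≠ 0 → ∀ f ∈ I, torusAction (RingHom.id K) w c f ∈ I) :
    IsWeightedHomogeneousIdeal w I := by
  classical
  intro f hf d
  set s : Finset ℕ := f.support.image (Finsupp.weight w) with hs
  have hsum : ∑ e ∈ s, weightedHomogeneousComponent w e f = f := by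
    conv_rhs => rw [f.as_sum]
    rw [← Finset.sum_fiberwise_of_maps_to (g := Finsupp.weight w) (t := s)
      fun x hx => Finset.mem_image_of_mem _ hx]
    exact Finset.sum_congr rfl fun e _ => weightedHomogeneousComponent_apply ..
  by_cases hd : d ∈ s
  swap
  · rw [weightedHomogeneousComponent_eq_zero']
    · exact I.zero_mem
    · intro e he hed
      exact hd (hed ▸ Finset.mem_image_of_mem _ he)
  rw [← Submodule.restrictScalars_mem K, ← Submodule.Quotient.mk_eq_zero,
    ← Module.forall_dual_apply_eq_zero_iff K]
  intro φ
  let v : ℕ → K := fun e =>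
    φ (Submodule.Quotient.mk (p := I.restrictScalars K) (weightedHomogeneousComponent w e f))
  let P : Polynomial K := ∑ e ∈ s, Polynomial.monomial e (v e)
  have hroot : ∀ c : K, c ≠ 0 → P.eval c = 0 := by
    intro c hc
    have h1 := h c hc f hf
    rw [← hsum, map_sum] at h1
    simp only [torusAction_weightedHomogeneousComponent] at h1
    rw [← Submodule.restrictScalars_mem K, ← Submodule.Quotient.mk_eq_zero] at h1
    have h2 := congrArg φ h1
    rw [map_zero, ← Submodule.mkQ_apply, map_sum, map_sum] at h2
    simp only [map_smul, smul_eq_mul, Submodule.mkQ_apply] at h2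
    simpa [P, Polynomial.eval_finsetSum, v, mul_comm] using h2
  have hP : P = 0 := by
    refine Polynomial.eq_zero_of_infinite_isRoot P ?_
    refine Set.Infinite.mono (s := {0}ᶜ) (fun c hc => hroot c hc) ?_
    exact (Set.finite_singleton (0 : K)).infinite_compl
  have := congrArg (fun Q => Polynomial.coeff Q d) hP
  simpa [P, Polynomial.finsetSum_coeff, Polynomial.coeff_monomial, hd, v] using this

theorem IsWeightedHomogeneousIdeal.of_mem_minimalPrimes {w : σ → ℕ}
    {I P : Ideal (MvPolynomial σ K)} (hI : IsWeightedHomogeneousIdeal w I)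
    (hP : P ∈ I.minimalPrimes) : IsWeightedHomogeneousIdeal w P := by
  let := weightedGradedAlgebra K w
  rw [isWeightedHomogeneousIdeal_iff] at hI ⊢
  have hle := Ideal.toIdeal_homogeneousCore_le (weightedHomogeneousSubmodule K w) P
  have hprime := hP.1.1.homogeneousCore (𝒜 := weightedHomogeneousSubmodule K w)
  have hIle : I ≤ (P.homogeneousCore (weightedHomogeneousSubmodule K w)).toIdeal := by
    rw [← hI.toIdeal_homogeneousCore_eq_self]
    exact Ideal.homogeneousCore_mono _ hP.1.2
  have heq := le_antisymm hle (hP.2 ⟨hprime, hIle⟩ hle)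
  rw [← heq]
  exact (P.homogeneousCore (weightedHomogeneousSubmodule K w)).isHomogeneous

/-- If all weights are positive, the elements of a proper weighted homogeneous ideal have no
constant term. -/
theorem IsWeightedHomogeneousIdeal.constantCoeff_eq_zero {w : σ → ℕ} (hw : ∀ i, 0 < w i)
    {I : Ideal (MvPolynomial σ K)} (hI : IsWeightedHomogeneousIdeal w I) (htop : I ≠ ⊤)
    {f : MvPolynomial σ K} (hf : f ∈ I) : constantCoeff f = 0 := by
  by_contra hne
  have h0 := hI f hf 0
  rw [weightedHomogeneousComponent_zero f fun i => (hw i).ne'] at h0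
  exact htop (I.eq_top_of_isUnit_mem h0 ((IsUnit.mk0 _ hne).map C))

end WeightedHomogeneous

/-! ### Smoothness of a cone at its vertex -/

section Smooth

theorem mem_idealOfVars_iff {σ R : Type*} [CommSemiring R] (f : MvPolynomial σ R) :
    f ∈ idealOfVars σ R ↔ constantCoeff f = 0 := by
  rw [← pow_one (idealOfVars σ R), mem_pow_idealOfVars_iff, constantCoeff_eq,
    ← notMem_support_iff]
  refine ⟨fun h h0 => by simpa using h 0 h0, fun h d hd => ?_⟩
  rw [Nat.one_le_iff_ne_zero, Ne, Finsupp.degree_eq_zero_iff]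
  rintro rfl
  exact h hd

variable {κ : Type*} {K : Type*} [Field K] {B : Type*} [CommRing B] [Algebra K B]

/-- Infinitesimal lifting for homomorphisms that factor through the local ring at a smooth point. -/
theorem exists_lift_of_isSmoothAt (o : Ideal B) [o.IsPrime] [Algebra.IsSmoothAt K o]
    {C C' : Type*} [CommRing C] [CommRing C'] [Algebra K C] [Algebra K C'] (π : C →ₐ[K] C')
    (hπ : Function.Surjective π) (hsq : ∀ x y, π x = 0 → π y = 0 → x * y = 0) (b : B →ₐ[K] C')
    (hb : ∀ y ∉ o, IsUnit (b y)) : ∃ s : B →ₐ[K] C, ∀ x, π (s x) = b x := by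
  have hnil : IsNilpotent (RingHom.ker π) := by
    refine ⟨2, ?_⟩
    rw [Ideal.zero_eq_bot, eq_bot_iff, pow_two, Ideal.mul_le]
    exact fun x hx y hy => hsq x y hx hy
  let l : Localization.AtPrime o →ₐ[K] C' :=
    IsLocalization.liftAlgHom (M := o.primeCompl) (f := b) fun y => hb y y.2
  refine ⟨(Algebra.FormallySmooth.liftOfSurjective l π hπ hnil).comp
    (IsScalarTower.toAlgHom K B (Localization.AtPrime o)), fun x => ?_⟩
  rw [AlgHom.comp_apply, Algebra.FormallySmooth.liftOfSurjective_apply]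
  exact IsLocalization.lift_eq (M := o.primeCompl) (g := (b : B →+* C')) _ x

/-- A quotient of a polynomial ring by relations without linear terms that is smooth at the origin
has no relations at all. If `J` is the kernel and `𝔫` the ideal of the variables, then
`B_𝔬 → K[x] / (J + 𝔫 ^ (e + 1))` lifts to `K[x] / 𝔫 ^ (e + 1)` as soon as `J ≤ 𝔫 ^ e`, and the lift
is the natural map on `𝔫 ^ 2`; hence `J ≤ 𝔫 ^ (e + 1)`. -/
theorem injective_of_isSmoothAt_of_ker_le (g : MvPolynomial κ K →ₐ[K] B)
    (hg : Function.Surjective g) (hker : RingHom.ker g ≤ idealOfVars κ K ^ 2)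
    (o : Ideal B) [o.IsPrime] (ho : o.comap g = idealOfVars κ K) [Algebra.IsSmoothAt K o] :
    Function.Injective g := by
  set 𝔫 := idealOfVars κ K with h𝔫
  set J : Ideal (MvPolynomial κ K) := RingHom.ker g with hJ
  have hJn : J ≤ 𝔫 := hker.trans (Ideal.pow_le_self two_ne_zero)
  -- The inductive step: `J ≤ 𝔫 ^ e` implies `J ≤ 𝔫 ^ (e + 1)`.
  have step : ∀ e, J ≤ 𝔫 ^ e → J ≤ 𝔫 ^ (e + 1) := by
    intro e hJe
    have hle : 𝔫 ^ (e + 1) ≤ J ⊔ 𝔫 ^ (e + 1) := le_sup_right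
    let q := Ideal.Quotient.mkₐ K (𝔫 ^ (e + 1))
    let p := Ideal.Quotient.mkₐ K (J ⊔ 𝔫 ^ (e + 1))
    let π : (MvPolynomial κ K ⧸ 𝔫 ^ (e + 1)) →ₐ[K] MvPolynomial κ K ⧸ (J ⊔ 𝔫 ^ (e + 1)) :=
      Ideal.Quotient.factorₐ K hle
    have hπ : ∀ x, π (q x) = p x := fun x => rfl
    have hπs : Function.Surjective π := Ideal.Quotient.factor_surjective hle
    -- The kernel of `π` is annihilated by `𝔫`; in particular its square is zero.
    have hmul : ∀ x ∈ J ⊔ 𝔫 ^ (e + 1), ∀ y ∈ 𝔫, q x * q y = 0 := by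
      intro x hx y hy
      rw [← map_mul]
      refine Ideal.Quotient.eq_zero_iff_mem.mpr ?_
      rw [pow_succ]
      exact Ideal.mul_mem_mul (sup_le hJe (Ideal.pow_le_pow_right (Nat.le_succ e)) hx) hy
    have hkerπ : ∀ z, π z = 0 → ∃ x ∈ J ⊔ 𝔫 ^ (e + 1), q x = z := by
      intro z hz
      obtain ⟨x, rfl⟩ := Ideal.Quotient.mk_surjective z
      exact ⟨x, Ideal.Quotient.eq_zero_iff_mem.mp hz, rfl⟩
    have hsubn : J ⊔ 𝔫 ^ (e + 1) ≤ 𝔫 := sup_le hJn (Ideal.pow_le_self (Nat.succ_ne_zero e))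
    let b : B →ₐ[K] MvPolynomial κ K ⧸ (J ⊔ 𝔫 ^ (e + 1)) :=
      (Ideal.Quotient.factorₐ K (le_sup_left : J ≤ J ⊔ 𝔫 ^ (e + 1))).comp
        (Ideal.quotientKerAlgEquivOfSurjective hg).symm.toAlgHom
    have hb : ∀ x, b (g x) = p x := by
      intro x
      have h1 : (Ideal.quotientKerAlgEquivOfSurjective hg).symm (g x) =
          Ideal.Quotient.mk (RingHom.ker g) x := by
        rw [AlgEquiv.symm_apply_eq]
        rfl
      change Ideal.Quotient.factorₐ K (le_sup_left : J ≤ J ⊔ 𝔫 ^ (e + 1))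
        ((Ideal.quotientKerAlgEquivOfSurjective hg).symm (g x)) = _
      rw [h1]
      rfl
    have hunit : ∀ y ∉ o, IsUnit (b y) := by
      intro y hy
      obtain ⟨x, rfl⟩ := hg y
      have hx : constantCoeff x ≠ 0 := by
        rw [Ne, ← mem_idealOfVars_iff, ← h𝔫, ← ho]
        exact hy
      rw [hb, ← add_sub_cancel (C (constantCoeff x)) x, map_add]
      refine IsNilpotent.isUnit_add_left_of_commute ⟨e + 1, ?_⟩ ?_ (Commute.all _ _)
      · rw [← map_pow]
        refine Ideal.Quotient.eq_zero_iff_mem.mpr (hle ?_)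
        refine Ideal.pow_mem_pow ?_ _
        rw [h𝔫, mem_idealOfVars_iff]
        simp
      · exact ((IsUnit.mk0 _ hx).map C).map p
    obtain ⟨s, hs⟩ := exists_lift_of_isSmoothAt o π hπs (fun a b ha hb => by
      obtain ⟨x, hx, rfl⟩ := hkerπ a ha
      obtain ⟨y, hy, rfl⟩ := hkerπ b hb
      exact hmul x hx y (hsubn hy)) b hunit
    let φ : MvPolynomial κ K →ₐ[K] MvPolynomial κ K ⧸ 𝔫 ^ (e + 1) := s.comp g
    have hφ : ∀ x, ∃ y ∈ J ⊔ 𝔫 ^ (e + 1), φ x = q x + q y := by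
      intro x
      obtain ⟨y, hy, hy'⟩ := hkerπ (φ x - q x) (by
        rw [map_sub, AlgHom.comp_apply, hs, hb, hπ, sub_self])
      exact ⟨y, hy, by rw [hy', add_sub_cancel]⟩
    -- `φ` agrees with `q` modulo the kernel of `π`, hence exactly on products of elements of `𝔫`.
    have hφq : ∀ x ∈ 𝔫 ^ 2, φ x = q x := by
      intro x hx
      rw [pow_two] at hx
      induction hx using Submodule.mul_induction_on' with
      | mem_mul_mem x hx y hy =>
        obtain ⟨a, ha, ha'⟩ := hφ x
        obtain ⟨c, hc, hc'⟩ := hφ y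
        rw [map_mul φ, ha', hc', map_mul, add_mul, mul_add, mul_add,
          hmul a ha y hy, hmul a ha c (hsubn hc), mul_comm (q x) (q c), hmul c hc x hx]
        simp only [add_zero]
      | add x _ y _ hx hy => rw [map_add φ, hx, hy, map_add]
    intro x hx
    have h0 : φ x = 0 := by
      rw [AlgHom.comp_apply, show g x = 0 from hx, map_zero]
    rw [hφq x (hker hx)] at h0
    exact Ideal.Quotient.eq_zero_iff_mem.mp h0
  have hall : ∀ e, J ≤ 𝔫 ^ e := by
    intro e
    induction e with
    | zero => simp
    | succ e ih => exact step e ih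
  rw [injective_iff_map_eq_zero]
  intro x hx
  by_contra hne
  obtain ⟨d, hd⟩ := Finset.nonempty_of_ne_empty (mt support_eq_empty.mp hne)
  have := (mem_pow_idealOfVars_iff _ _).mp (hall (Finsupp.degree d + 1) hx) d hd
  omega

end Smooth

section Coordinates

variable {σ : Type*} {K : Type*} [Field K]

/-- A polynomial is its constant term plus its linear part, up to terms of degree at least two. -/
theorem sub_linear_mem_idealOfVars_pow_two [Fintype σ] (f : MvPolynomial σ K) :
    f - (C (constantCoeff f) + ∑ i, C (f.coeff (Finsupp.single i 1)) * X i) ∈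
      idealOfVars σ K ^ 2 := by
  classical
  rw [mem_pow_idealOfVars_iff]
  intro d hd
  by_contra! hlt
  rw [mem_support_iff] at hd
  apply hd
  simp only [coeff_sub, coeff_add, coeff_sum, coeff_C_mul, coeff_C, coeff_X]
  rcases Nat.lt_succ_iff_lt_or_eq.mp hlt with h0 | h1
  · obtain rfl : d = 0 := (Finsupp.degree_eq_zero_iff d).mp (by omega)
    simp [constantCoeff_eq]
  · obtain ⟨i, rfl⟩ : ∃ i, d = Finsupp.single i 1 := by
      have : d ∈ Set.range fun i : σ => Finsupp.single i 1 := by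
        rwa [Finsupp.range_single_one]
      exact this.imp fun _ h => h.symm
    have : ∀ k, (Finsupp.single k 1 = (Finsupp.single i 1 : σ →₀ ℕ)) ↔ k = i := fun k =>
      (Finsupp.single_left_injective one_ne_zero).eq_iff
    simp [this, eq_comm (a := (0 : σ →₀ ℕ))]

/-- Graded Nakayama lemma: variables that span the cotangent space `𝔫 / (𝔫 ^ 2 + I)` at the origin
of the zero locus of a weighted homogeneous ideal `I`, the kernel of `π`, generate its coordinate
ring. -/
theorem surjective_of_span_cotangent {w : σ → ℕ} (hw : ∀ i, 0 < w i)
    {B : Type*} [CommRing B] [Algebra K B] (π : MvPolynomial σ K →ₐ[K] B)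
    (hI : IsWeightedHomogeneousIdeal w (RingHom.ker π)) (hπ : Function.Surjective π)
    {κ : Type*} (a : κ → σ)
    (ha : ∀ i, ∃ c : κ →₀ K,
      X i - (c.sum fun k r => C r * X (a k)) ∈ idealOfVars σ K ^ 2 ⊔ RingHom.ker π) :
    Function.Surjective (π.comp (rename a)) := by
  classical
  set g := π.comp (rename a : MvPolynomial κ K →ₐ[K] MvPolynomial σ K)
  have hgX : ∀ k, π (X (a k)) ∈ g.range := fun k => ⟨X k, by simp [g]⟩
  have hC : ∀ r, π (C r) ∈ g.range := fun r => ⟨C r, by simp [g]⟩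
  have key : ∀ e i, w i = e → π (X i) ∈ g.range := by
    intro e
    induction e using Nat.strong_induction_on with
    | _ e ih =>
      intro i hi
      obtain ⟨c, hc⟩ := ha i
      obtain ⟨q, hq, r, hr, hqr⟩ := Submodule.mem_sup.mp hc
      have hX : (X i : MvPolynomial σ K) =
          (c.sum fun k r => C r * weightedHomogeneousComponent w e (X (a k))) +
            weightedHomogeneousComponent w e q + weightedHomogeneousComponent w e r := by
        have h1 : (X i : MvPolynomial σ K) = (c.sum fun k r => C r * X (a k)) + (q + r) := by
          rw [hqr]; ring
        have h2 := congrArg (weightedHomogeneousComponent w e) h1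
        rw [weightedHomogeneousComponent_eq_self (hi ▸ isWeightedHomogeneous_X K w i), map_add,
          map_add, ← add_assoc, Finsupp.sum, map_sum] at h2
        simpa only [weightedHomogeneousComponent_C_mul, Finsupp.sum] using h2
      rw [hX, map_add, map_add]
      refine add_mem (add_mem ?_ ?_) ?_
      · rw [Finsupp.sum, map_sum]
        refine sum_mem fun k _ => ?_
        rw [map_mul]
        refine mul_mem (hC _) ?_
        by_cases hk : w (a k) = e
        · rw [weightedHomogeneousComponent_eq_self (hk ▸ isWeightedHomogeneous_X K w (a k))]
          exact hgX k
        · rw [(isWeightedHomogeneous_X K w (a k)).weightedHomogeneousComponent_ne e (Ne.symm hk),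
            map_zero]
          exact zero_mem _
      · rw [weightedHomogeneousComponent_apply, map_sum]
        refine sum_mem fun d hd => ?_
        rw [Finset.mem_filter] at hd
        have hdeg := (mem_pow_idealOfVars_iff _ _).mp hq d hd.1
        rw [monomial_eq, map_mul, Finsupp.prod, map_prod]
        refine mul_mem (hC _) (prod_mem fun k hk => ?_)
        rw [map_pow]
        refine pow_mem (ih (w k) ?_ k rfl) _
        -- A variable that occurs in a monomial of degree at least two has smaller weight.
        have hk1 : 1 ≤ d k := Nat.one_le_iff_ne_zero.mpr (Finsupp.mem_support_iff.mp hk)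
        obtain ⟨d', rfl⟩ := exists_add_of_le (Finsupp.single_le_iff.mpr hk1)
        have hd' : d' ≠ 0 := by
          rintro rfl
          simp at hdeg
        have hw' : Finsupp.weight w d' ≠ 0 := fun h0 =>
          hd' (Finsupp.ext
            ((weightedDegree_eq_zero_iff (nonTorsionWeight_of fun i => (hw i).ne')).mp h0))
        have h3 := hd.2
        rw [map_add, Finsupp.weight_single, one_smul] at h3
        omega
      · rw [show π (weightedHomogeneousComponent w e r) = 0 from hI r hr e]
        exact zero_mem _
  intro b
  obtain ⟨f, rfl⟩ := hπ b
  change _ ∈ g.range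
  induction f using MvPolynomial.induction_on with
  | C r => exact hC r
  | add p q hp hq => rw [map_add]; exact add_mem hp hq
  | mul_X p i hp => rw [map_mul]; exact mul_mem hp (key _ i rfl)

/-- A cone that is smooth at its vertex is an affine space: if the variables have positive weights,
the kernel of `π : K[x] → B` is a proper weighted homogeneous ideal, and `B` is smooth over `K` at
the origin, then `B` is a polynomial ring in those variables that represent a basis of the cotangent
space at the origin. -/
theorem exists_algEquiv_mvPolynomial_of_mem_smoothLocus [Finite σ] {w : σ → ℕ} (hw : ∀ i, 0 < w i)
    {B : Type*} [CommRing B] [Algebra K B] (π : MvPolynomial σ K →ₐ[K] B)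
    (hI : IsWeightedHomogeneousIdeal w (RingHom.ker π)) (htop : RingHom.ker π ≠ ⊤)
    (hπ : Function.Surjective π) (o : PrimeSpectrum B) (hs : o ∈ Algebra.smoothLocus K B)
    (ho : o.asIdeal.comap π = idealOfVars σ K) :
    ∃ d : ℕ, Nonempty (MvPolynomial (Fin d) K ≃ₐ[K] B) := by
  classical
  set I : Ideal (MvPolynomial σ K) := RingHom.ker π
  let V := MvPolynomial σ K ⧸ (idealOfVars σ K ^ 2 ⊔ I).restrictScalars K
  let mkV : MvPolynomial σ K →ₗ[K] V := Submodule.mkQ _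
  have hmkV : ∀ f, mkV f = 0 ↔ f ∈ idealOfVars σ K ^ 2 ⊔ I := fun f =>
    Submodule.Quotient.mk_eq_zero _
  obtain ⟨κ, a, hainj, hspan, hlin⟩ := exists_linearIndependent' K fun i : σ => mkV (X i)
  have : Finite κ := Finite.of_injective a hainj
  let := Fintype.ofFinite κ
  set g := π.comp (rename a : MvPolynomial κ K →ₐ[K] MvPolynomial σ K) with hg
  have hsurj : Function.Surjective g := by
    refine surjective_of_span_cotangent hw π hI hπ a fun i => ?_
    have hi : mkV (X i) ∈ Submodule.span K (Set.range ((fun i : σ => mkV (X i)) ∘ a)) :=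
      hspan ▸ Submodule.subset_span ⟨i, rfl⟩
    obtain ⟨c, hc⟩ := (Finsupp.mem_span_range_iff_exists_finsupp).mp hi
    refine ⟨c, (hmkV _).mp ?_⟩
    rw [map_sub, ← hc, Finsupp.sum, Finsupp.sum, map_sum, sub_eq_zero]
    simp only [← smul_eq_C_mul, map_smul, Function.comp_apply]
  have hrename : ∀ f ∈ idealOfVars κ K ^ 2, rename a f ∈ idealOfVars σ K ^ 2 := by
    have hle : (idealOfVars κ K).map (rename a : MvPolynomial κ K →ₐ[K] MvPolynomial σ K) ≤
        idealOfVars σ K := by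
      rw [Ideal.map_le_iff_le_comap]
      intro f hf
      rw [mem_idealOfVars_iff] at hf
      rw [Ideal.mem_comap, mem_idealOfVars_iff, constantCoeff_rename, hf]
    intro f hf
    have := Ideal.mem_map_of_mem (rename a : MvPolynomial κ K →ₐ[K] MvPolynomial σ K) hf
    rw [Ideal.map_pow] at this
    exact Ideal.pow_right_mono hle 2 this
  have hker : RingHom.ker g ≤ idealOfVars κ K ^ 2 := by
    intro f hf
    have hfI : rename a f ∈ I := hf
    have h0 : constantCoeff f = 0 := by
      have := hI.constantCoeff_eq_zero hw htop hfI
      rwa [constantCoeff_rename] at this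
    have h1 := sub_linear_mem_idealOfVars_pow_two f
    rw [h0, C_0, zero_add] at h1
    have h2 := hrename _ h1
    have h3 : mkV (rename a (∑ i, C (f.coeff (Finsupp.single i 1)) * X i)) = 0 := by
      rw [map_sub] at h2
      rw [hmkV]
      have := sub_mem (Ideal.mem_sup_right (S := idealOfVars σ K ^ 2) hfI)
        (Ideal.mem_sup_left (T := I) h2)
      rwa [sub_sub_cancel] at this
    have h4 : ∑ i, f.coeff (Finsupp.single i 1) • mkV (X (a i)) = 0 := by
      rw [map_sum, map_sum] at h3
      simpa only [map_mul, rename_C, rename_X, ← smul_eq_C_mul, map_smul] using h3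
    have h5 := Fintype.linearIndependent_iff.mp hlin _ h4
    simpa only [h5, C_0, zero_mul, Finset.sum_const_zero, sub_zero] using h1
  have hcomap : o.asIdeal.comap g = idealOfVars κ K := by
    ext f
    have : f ∈ o.asIdeal.comap g ↔ rename a f ∈ o.asIdeal.comap π := Iff.rfl
    rw [this, ho, mem_idealOfVars_iff, mem_idealOfVars_iff, constantCoeff_rename]
  have : Algebra.IsSmoothAt K o.asIdeal := hs
  have hinj := injective_of_isSmoothAt_of_ker_le g hsurj hker o.asIdeal hcomap
  exact ⟨Nat.card κ, ⟨(renameEquiv K (Finite.equivFin κ).symm).trans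
    (AlgEquiv.ofBijective g ⟨hinj, hsurj⟩)⟩⟩

/-- The form of `exists_algEquiv_mvPolynomial_of_mem_smoothLocus` for a closed subscheme of an
affine cone `Spec R` with vertex `v`. -/
theorem exists_algEquiv_mvPolynomial_quotient [Finite σ] {w : σ → ℕ} (hw : ∀ i, 0 < w i)
    {R : Type*} [CommRing R] [Algebra K R] (ρ : MvPolynomial σ K →ₐ[K] R)
    (hρ : Function.Surjective ρ) (v : PrimeSpectrum R)
    (hv : v.asIdeal.comap ρ = idealOfVars σ K) (V : Ideal R)
    (hV : IsWeightedHomogeneousIdeal w (V.comap ρ)) (htop : V.comap ρ ≠ ⊤)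
    (hs : ∃ o : PrimeSpectrum (R ⧸ V),
      PrimeSpectrum.comap (Ideal.Quotient.mk V) o = v ∧ o ∈ Algebra.smoothLocus K (R ⧸ V)) :
    ∃ d : ℕ, Nonempty (MvPolynomial (Fin d) K ≃ₐ[K] R ⧸ V) := by
  obtain ⟨o, rfl, hs⟩ := hs
  have hker : RingHom.ker ((Ideal.Quotient.mkₐ K V).comp ρ) = V.comap ρ := by
    ext f
    exact Ideal.Quotient.eq_zero_iff_mem
  refine exists_algEquiv_mvPolynomial_of_mem_smoothLocus hw ((Ideal.Quotient.mkₐ K V).comp ρ)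
    ?_ ?_ ((Ideal.Quotient.mkₐ_surjective K V).comp hρ) o hs hv
  · rwa [hker]
  · rwa [hker]

end Coordinates

/-! ### The torus acts on marked bases -/

section Equivariance

variable {A A' : Type*} [CommRing A] [CommRing A']

theorem support_torusAction {σ : Type*} (e : A ≃+* A') (w : σ → ℕ) (c : A'ˣ)
    (f : MvPolynomial σ A) : (torusAction (e : A →+* A') w c f).support = f.support := by
  ext d
  rw [mem_support_iff, mem_support_iff, coeff_torusAction, ← Units.val_pow_eq_pow_val, Ne,
    Units.mul_right_eq_zero]
  simp

theorem support_C_unit_mul {σ : Type*} (u : Aˣ) (f : MvPolynomial σ A) :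
    (C (u : A) * f).support = f.support := by
  ext d
  rw [mem_support_iff, mem_support_iff, coeff_C_mul, Ne, Units.mul_right_eq_zero]

theorem torusAction_surjective {σ : Type*} (e : A ≃+* A') (w : σ → ℕ) (c : A'ˣ) :
    Function.Surjective (torusAction (e : A →+* A') w (c : A')) := by
  intro f
  refine ⟨torusAction (e.symm : A' →+* A) w (e.symm ((c⁻¹ : A'ˣ) : A')) f, ?_⟩
  ext d
  rw [coeff_torusAction, coeff_torusAction]
  simp [← mul_assoc, ← mul_pow]

variable {K : Type*} [Field K]

theorem isCompl_span_sousEscalier_iff {σ : Type*} (J : Ideal (MvPolynomial σ K))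
    (I : Ideal (MvPolynomial σ A)) :
    IsCompl (I.restrictScalars A)
        (Submodule.span A ((fun γ => monomial γ (1 : A)) '' sousEscalier J)) ↔
      (∀ x ∈ I, ↑x.support ⊆ sousEscalier J → x = 0) ∧
        ∀ x, ∃ y ∈ I, ∃ z : MvPolynomial σ A, ↑z.support ⊆ sousEscalier J ∧ y + z = x := by
  rw [← restrictSupport_eq_span, isCompl_iff, Submodule.disjoint_def,
    Submodule.codisjoint_iff_exists_add_eq]
  simp only [mem_restrictSupport_iff, Submodule.restrictScalars_mem]
  refine and_congr_right fun _ => forall_congr' fun x => ?_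
  exact ⟨fun ⟨y, z, hy, hz, h⟩ => ⟨y, hy, z, hz, h⟩, fun ⟨y, hy, z, hz, h⟩ => ⟨y, z, hy, hz, h⟩⟩

/-- The torus acts on the `𝒫(J)`-marked bases: the images of the polynomials are rescaled so as to
be monic again. -/
theorem IsHomogeneousMarkedBasis.torusAction {σ : Type*} {J : Ideal (MvPolynomial σ K)}
    {G : minGens J → MvPolynomial σ A} (hG : IsHomogeneousMarkedBasis J G) (e : A ≃+* A')
    (w : σ → ℕ) (c : A'ˣ) :
    IsHomogeneousMarkedBasis J fun β =>
      C ((c⁻¹ ^ Finsupp.weight w β.1 : A'ˣ) : A') *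
        torusAction (e : A →+* A') w (c : A') (G β) where
  isHomogeneous β d hd := by
    refine hG.isHomogeneous β ?_
    rwa [← mem_support_iff, support_C_unit_mul, support_torusAction, mem_support_iff] at hd
  coeff_head β := by
    rw [coeff_C_mul, coeff_torusAction, hG.coeff_head, RingEquiv.coe_toRingHom, map_one, mul_one]
    simp [← mul_pow]
  tail β γ hγ hne := by
    rw [support_C_unit_mul, support_torusAction] at hγ
    exact hG.tail β γ hγ hne
  isCompl := by
    have hspan : Ideal.span (Set.range fun β : minGens J =>
        C ((c⁻¹ ^ Finsupp.weight w β.1 : A'ˣ) : A') *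
          Marked.torusAction (e : A →+* A') w (c : A') (G β)) =
        (Ideal.span (Set.range G)).map (Marked.torusAction (e : A →+* A') w (c : A')) := by
      rw [Ideal.map_span, ← Set.range_comp]
      refine le_antisymm (Ideal.span_le.mpr ?_) (Ideal.span_le.mpr ?_)
      · rintro _ ⟨β, rfl⟩
        exact Ideal.mul_mem_left _ _ (Ideal.subset_span ⟨β, rfl⟩)
      · rintro _ ⟨β, rfl⟩
        have h := Ideal.mul_mem_left _ (C ((c ^ Finsupp.weight w β.1 : A'ˣ) : A'))
          (Ideal.subset_span (s := Set.range fun β : minGens J =>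
            C ((c⁻¹ ^ Finsupp.weight w β.1 : A'ˣ) : A') *
              Marked.torusAction (e : A →+* A') w (c : A') (G β)) ⟨β, rfl⟩)
        simp only [← mul_assoc, ← C_mul, ← Units.val_mul, ← mul_pow, mul_inv_cancel, one_pow,
          Units.val_one, C_1, one_mul] at h
        exact h
    have hsurj := torusAction_surjective e w c
    obtain ⟨h1, h2⟩ := (isCompl_span_sousEscalier_iff _ _).mp hG.isCompl
    rw [hspan, isCompl_span_sousEscalier_iff]
    constructor
    · intro x hx hs
      obtain ⟨y, hy, rfl⟩ := (Ideal.mem_map_iff_of_surjective _ hsurj).mp hx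
      rw [support_torusAction] at hs
      rw [h1 y hy hs, map_zero]
    · intro x
      obtain ⟨x, rfl⟩ := hsurj x
      obtain ⟨y, hy, z, hz, rfl⟩ := h2 x
      exact ⟨_, Ideal.mem_map_of_mem _ hy, _, by rwa [support_torusAction], (map_add _ _ _).symm⟩

variable {n : ℕ}

theorem weight_cons_extend (ω : Fin n → ℕ) (a : ℕ) (γ : Fin n →₀ ℕ) :
    Finsupp.weight (Fin.cons 0 ω : Fin (n + 1) → ℕ)
      (Finsupp.single 0 a + Finsupp.mapDomain Fin.succ γ) = Finsupp.weight ω γ := by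
  rw [map_add, Finsupp.weight_single, Finsupp.weight_apply, Finsupp.weight_apply,
    Finsupp.sum_mapDomain_index (by simp) (by simp [add_mul])]
  simp

/-- Homogenization commutes with the torus action, the new variable `x₀` having weight `0`. -/
theorem homogenization_C_mul_torusAction (e : A ≃+* A') (ω : Fin n → ℕ) (c u : A'ˣ)
    (f : MvPolynomial (Fin n) A) :
    homogenization (C (u : A') * torusAction (e : A →+* A') ω (c : A') f) =
      C (u : A') * torusAction (e : A →+* A') (Fin.cons 0 ω) (c : A') (homogenization f) := by
  have hs : (C (u : A') * torusAction (e : A →+* A') ω (c : A') f).support = f.support := by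
    rw [support_C_unit_mul, support_torusAction]
  have hd : (C (u : A') * torusAction (e : A →+* A') ω (c : A') f).totalDegree =
      f.totalDegree := by
    rw [totalDegree, hs, totalDegree]
  rw [homogenization, hs, hd, homogenization, map_sum, Finset.mul_sum]
  refine Finset.sum_congr rfl fun γ _ => ?_
  rw [torusAction_monomial, weight_cons_extend, C_mul_monomial, coeff_C_mul, coeff_torusAction]

/-- The coefficient of `x^α` in `f` is that of the corresponding term in `x₀ ^ k * f^h`. If `x^α`
does not occur in `f`, both vanish, whatever the truncated subtraction yields. -/
theorem coeff_X_pow_mul_homogenization (f : MvPolynomial (Fin n) A) (k : ℕ) (α : Fin n →₀ ℕ) :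
    (X 0 ^ k * homogenization f).coeff
      (Finsupp.single 0 (k + (f.totalDegree - Finsupp.degree α)) +
        Finsupp.mapDomain Fin.succ α) = f.coeff α := by
  classical
  rw [Finsupp.single_add, add_assoc, X_pow_eq_monomial, coeff_monomial_mul, one_mul,
    homogenization, coeff_sum, Finset.sum_eq_single α]
  · rw [coeff_monomial, if_pos rfl]
  · intro γ _ hne
    rw [coeff_monomial, if_neg]
    intro h
    apply hne
    ext i
    have := DFunLike.congr_fun h i.succ
    simpa [Finsupp.mapDomain_apply (Fin.succ_injective n)] using this
  · intro h
    rw [notMem_support_iff.mp h, monomial_zero, coeff_zero]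

/-- The torus acts on the `[𝒫(𝔧), m]`-marked bases. -/
theorem IsMarkedBasis.torusAction {j : Ideal (MvPolynomial (Fin n) K)} {m : ℕ}
    {f : minGens j → MvPolynomial (Fin n) A} (hf : IsMarkedBasis j m f) (e : A ≃+* A')
    (ω : Fin n → ℕ) (c : A'ˣ) :
    IsMarkedBasis j m fun α =>
      C ((c⁻¹ ^ Finsupp.weight ω α.1 : A'ˣ) : A') *
        torusAction (e : A →+* A') ω (c : A') (f α) where
  coeff_head α := by
    rw [coeff_C_mul, coeff_torusAction, hf.coeff_head, RingEquiv.coe_toRingHom, map_one, mul_one]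
    simp [← mul_pow]
  tail α γ hγ hne := by
    rw [support_C_unit_mul, support_torusAction] at hγ
    exact hf.tail α γ hγ hne
  exists_homogeneous := by
    obtain ⟨G, hG, h⟩ := hf.exists_homogeneous
    refine ⟨_, hG.torusAction e (Fin.cons 0 ω) c, fun α => ?_⟩
    obtain ⟨k, β, hβ⟩ := h α
    refine ⟨k, β, ?_⟩
    rcases subsingleton_or_nontrivial A with hA | hA
    · have := e.symm.injective.subsingleton
      exact Subsingleton.elim _ _
    -- The head term of `x₀ ^ k * (f α)^h` as a member of `G` comes from `x^α`, because `x^α` is the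
    -- only term of `f α` in `𝔧`.
    have hw : Finsupp.weight (Fin.cons 0 ω : Fin (n + 1) → ℕ) β.1 = Finsupp.weight ω α.1 := by
      have hc := coeff_X_pow_mul_homogenization (f α) k α.1
      rw [hβ, hf.coeff_head] at hc
      set δ := Finsupp.single 0 (k + ((f α).totalDegree - Finsupp.degree α.1)) +
        Finsupp.mapDomain Fin.succ α.1
      have hδ : δ ∈ (G β).support := by
        rw [mem_support_iff, hc]
        exact one_ne_zero
      have hdeg : Finsupp.degree δ = Finsupp.degree β.1 := by
        have := hG.isHomogeneous β (mem_support_iff.mp hδ)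
        rw [← this, Finsupp.degree_eq_weight_one]
        rfl
      have hβδ : δ = β.1 := by
        by_contra hne
        refine hG.tail β δ hδ hne ?_
        rw [mem_terms_truncation, mem_terms_extend]
        exact ⟨α.2.prop, hdeg ▸ ((mem_terms_truncation _ _ _).mp β.2.prop).2⟩
      rw [← hβδ, weight_cons_extend]
    rw [homogenization_C_mul_torusAction, ← hβ, map_mul, map_pow, hw]
    have hX : Marked.torusAction (e : A →+* A') (Fin.cons 0 ω) (c : A') (X (0 : Fin (n + 1))) =
        X 0 := by
      simp [Marked.torusAction]
    rw [hX]
    ring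

end Equivariance

/-! ### The marked scheme is a cone -/

section Cone

variable {n : ℕ} {K : Type u} [Field K]

/-- Dickson's lemma. -/
theorem minGens_finite {σ : Type*} [Finite σ] (J : Ideal (MvPolynomial σ K)) :
    (minGens J).Finite :=
  WellQuasiOrderedLE.finite_of_isAntichain (setOfPred_minimal_antichain _)

instance finite_param (j : Ideal (MvPolynomial (Fin n) K)) (m : ℕ) : Finite (Param j m) := by
  have := (minGens_finite j).to_subtype
  infer_instance

/-- The weight of the parameter `C (α, γ)`: the difference of the `ω`-degrees of `x^α` and
`x^γ`. The subtraction does not truncate when `ω` defines an affine segment. -/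
noncomputable def paramWeight (j : Ideal (MvPolynomial (Fin n) K)) (m : ℕ) (ω : Fin n → ℕ)
    (p : Param j m) : ℕ :=
  Finsupp.weight ω p.1.1 - Finsupp.weight ω p.2.1

/-- On marked sets, the torus action followed by the normalization of the head terms multiplies each
parameter by the power of `c⁻¹` given by its weight. -/
theorem C_mul_torusAction_markedSet {A A' : Type*} [CommRing A] [CommRing A']
    (j : Ideal (MvPolynomial (Fin n) K)) (m : ℕ) (e : A →+* A') (ω : Fin n → ℕ) (c : A'ˣ)
    (hω : ∀ p : Param j m, Finsupp.weight ω p.2.1 ≤ Finsupp.weight ω p.1.1) (x : Param j m → A)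
    (α : minGens j) :
    C ((c⁻¹ ^ Finsupp.weight ω α.1 : A'ˣ) : A') *
        torusAction e ω (c : A') (markedSet j m x α) =
      markedSet j m (fun p => ((c⁻¹ ^ paramWeight j m ω p : A'ˣ) : A') * e (x p)) α := by
  rw [markedSet, markedSet, map_add, map_sum, mul_add, Finset.mul_sum]
  congr 1
  · rw [torusAction_monomial, C_mul_monomial, map_one, mul_one]
    congr 1
    simp [← mul_pow]
  · refine Finset.sum_congr rfl fun γ _ => ?_
    rw [torusAction_monomial, C_mul_monomial]
    congr 1
    have h := Nat.sub_add_cancel (hω ⟨α, γ⟩)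
    rw [← mul_assoc, ← Units.val_pow_eq_pow_val, ← Units.val_mul]
    congr 2
    rw [paramWeight]
    dsimp only at h ⊢
    conv_lhs => rw [← h]
    rw [pow_add, mul_assoc, ← mul_pow, inv_mul_cancel, one_pow, mul_one]

/-- The ideal of the relations is stable under the torus, because the torus acts on marked
bases. -/
theorem torusAction_mem_relations (j : Ideal (MvPolynomial (Fin n) K)) (m : ℕ) (ω : Fin n → ℕ)
    (hω : ∀ p : Param j m, Finsupp.weight ω p.2.1 ≤ Finsupp.weight ω p.1.1) (c : K) (hc : c ≠ 0)
    (f : MvPolynomial (Param j m) K) (hf : f ∈ relations j m) :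
    torusAction (RingHom.id K) (paramWeight j m ω) c f ∈ relations j m := by
  rw [relations, Ideal.mem_sInf] at hf ⊢
  intro 𝔞 h𝔞
  let τ : MvPolynomial (Param j m) K →+* MvPolynomial (Param j m) K :=
    torusAction (RingHom.id K) (paramWeight j m ω) c
  have hτ : Function.Surjective τ :=
    torusAction_surjective (RingEquiv.refl K) (paramWeight j m ω) (Units.mk0 c hc)
  -- The preimage of `𝔞` under the action occurs in the infimum too: its quotient ring is isomorphic
  -- to that of `𝔞`, and the two marked sets correspond up to the action on `x`.
  refine hf (I := 𝔞.comap τ) ?_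
  let ε : (MvPolynomial (Param j m) K ⧸ 𝔞.comap τ) ≃+* MvPolynomial (Param j m) K ⧸ 𝔞 :=
    RingEquiv.ofBijective (Ideal.quotientMap 𝔞 τ le_rfl)
      ⟨Ideal.quotientMap_injective, Ideal.quotientMap_surjective hτ⟩
  have hε : ∀ x, ε (Ideal.Quotient.mk _ x) = Ideal.Quotient.mk _ (τ x) := fun x => rfl
  let u : (MvPolynomial (Param j m) K ⧸ 𝔞.comap τ)ˣ :=
    (Units.mk0 c hc).map ((Ideal.Quotient.mk (𝔞.comap τ)).comp C : K →+* _)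
  have hu : ∀ k, ((u ^ k : (MvPolynomial (Param j m) K ⧸ 𝔞.comap τ)ˣ) :
      MvPolynomial (Param j m) K ⧸ 𝔞.comap τ) = Ideal.Quotient.mk _ (C (c ^ k)) := by
    intro k
    rw [map_pow, map_pow]
    rfl
  -- The inverse torus element appears because the action on `x` multiplies the parameter `p` by the
  -- power of the inverse with exponent `paramWeight j m ω p`.
  have key := IsMarkedBasis.torusAction h𝔞 ε.symm ω u⁻¹
  simp only [C_mul_torusAction_markedSet j m _ ω _ hω] at key
  have hparam : ∀ p : Param j m, (((u⁻¹)⁻¹ ^ paramWeight j m ω p :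
      (MvPolynomial (Param j m) K ⧸ 𝔞.comap τ)ˣ) : MvPolynomial (Param j m) K ⧸ 𝔞.comap τ) *
        (ε.symm : _ →+* _) (Ideal.Quotient.mk 𝔞 (X p)) = Ideal.Quotient.mk _ (X p) := by
    intro p
    apply ε.injective
    rw [inv_inv, hu, map_mul, hε, hε, RingEquiv.coe_toRingHom, RingEquiv.apply_symm_apply,
      ← map_mul]
    congr 1
    simp [τ, torusAction]
  simp only [hparam] at key
  exact key

theorem isWeightedHomogeneousIdeal_relations [Infinite K] (j : Ideal (MvPolynomial (Fin n) K))
    (m : ℕ) (ω : Fin n → ℕ)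
    (hω : ∀ p : Param j m, Finsupp.weight ω p.2.1 ≤ Finsupp.weight ω p.1.1) :
    IsWeightedHomogeneousIdeal (paramWeight j m ω) (relations j m) :=
  isWeightedHomogeneousIdeal_of_torusAction_mem _ _ (torusAction_mem_relations j m ω hω)

theorem comap_mk_vertex (j : Ideal (MvPolynomial (Fin n) K)) (m : ℕ) :
    (RingHom.ker (vertexHom j m)).comap (Ideal.Quotient.mk (relations j m)) =
      idealOfVars (Param j m) K := by
  ext f
  rw [mem_idealOfVars_iff]
  have : vertexHom j m (Ideal.Quotient.mk (relations j m) f) = constantCoeff f := by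
    change aeval (0 : Param j m → K) f = _
    rw [aeval_zero]
    rfl
  rw [← this]
  rfl

end Cone

/-! ### Irreducible components of the marked scheme -/

section Components

variable {n : ℕ} {K : Type u} [Field K] [Infinite K] {j : Ideal (MvPolynomial (Fin n) K)} {m : ℕ}

/-- The ideal in `K[C]` of an irreducible component of the marked scheme of an affine segment is
homogeneous for a grading in which all parameters have positive degree. -/
theorem IsAffineSegment.exists_weight (hj : IsAffineSegment j m)
    {Z : Set (PrimeSpectrum (CoordRing j m))}
    (hZ : Z ∈ irreducibleComponents (PrimeSpectrum (CoordRing j m))) :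
    ∃ w : Param j m → ℕ, (∀ p, 0 < w p) ∧ ∃ P : Ideal (MvPolynomial (Param j m) K),
      P = (PrimeSpectrum.vanishingIdeal Z).comap
        (Ideal.Quotient.mk (relations j m)) ∧
      P.IsPrime ∧ IsWeightedHomogeneousIdeal w P := by
  obtain ⟨_, _, ω, hω⟩ := hj
  have hlt : ∀ p : Param j m, Finsupp.weight ω p.2.1 < Finsupp.weight ω p.1.1 := fun p =>
    hω _ p.1.2 _ p.2.2.1 p.2.2.2
  have hmin : PrimeSpectrum.vanishingIdeal Z ∈
      minimalPrimes (CoordRing j m) := by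
    rw [PrimeSpectrum.vanishingIdeal_mem_minimalPrimes]
    have := (isClosed_of_mem_irreducibleComponents Z hZ).closure_eq
    exact this.symm ▸ hZ
  have hP : (PrimeSpectrum.vanishingIdeal Z).comap
        (Ideal.Quotient.mk (relations j m)) ∈ (relations j m).minimalPrimes := by
    rw [Ideal.minimalPrimes_eq_comap]
    exact ⟨_, hmin, rfl⟩
  exact ⟨paramWeight j m ω, fun p => Nat.sub_pos_of_lt (hlt p), _, rfl, hP.1.1,
    (isWeightedHomogeneousIdeal_relations j m ω fun p => (hlt p).le).of_mem_minimalPrimes hP⟩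

/-- Every irreducible component contains the vertex, since its ideal consists of polynomials without
constant term. -/
theorem IsAffineSegment.vertex_mem (hj : IsAffineSegment j m)
    {Z : Set (PrimeSpectrum (CoordRing j m))}
    (hZ : Z ∈ irreducibleComponents (PrimeSpectrum (CoordRing j m))) : vertex j m ∈ Z := by
  obtain ⟨w, hw, P, hP, hprime, hhom⟩ := hj.exists_weight hZ
  have hcl : IsClosed Z := isClosed_of_mem_irreducibleComponents Z hZ
  have hmem : (vertex j m : PrimeSpectrum (CoordRing j m)) ∈ PrimeSpectrum.zeroLocus
      (PrimeSpectrum.vanishingIdeal Z : Set (CoordRing j m)) := by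
    intro x hx
    obtain ⟨f, rfl⟩ := Ideal.Quotient.mk_surjective x
    have hf : f ∈ P := by rw [hP]; exact hx
    have := hhom.constantCoeff_eq_zero hw hprime.ne_top hf
    rw [← mem_idealOfVars_iff, ← comap_mk_vertex] at this
    exact this
  rw [PrimeSpectrum.zeroLocus_vanishingIdeal_eq_closure] at hmem
  exact hcl.closure_eq ▸ hmem

theorem IsAffineSegment.connectedSpace (hj : IsAffineSegment j m) :
    ConnectedSpace (markedScheme j m) := by
  have : PreconnectedSpace (markedScheme j m) := by
    refine ⟨isPreconnected_of_forall (vertex j m) fun x _ => ?_⟩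
    exact ⟨irreducibleComponent x, Set.subset_univ _,
      hj.vertex_mem (irreducibleComponent_mem_irreducibleComponents x),
      mem_irreducibleComponent, isIrreducible_irreducibleComponent.isPreirreducible.isPreconnected⟩
  exact { toNonempty := ⟨vertex j m⟩ }

/-- A component of the marked scheme of an affine segment that is smooth at the vertex is the
spectrum of a polynomial ring. -/
theorem IsAffineSegment.exists_algEquiv (hj : IsAffineSegment j m)
    {Z : Set (PrimeSpectrum (CoordRing j m))}
    (hZ : Z ∈ irreducibleComponents (PrimeSpectrum (CoordRing j m))) (hs : IsSmoothAtVertex j m Z) :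
    ∃ d : ℕ, Nonempty (MvPolynomial (Fin d) K ≃ₐ[K] ReducedCoordRing j m Z) := by
  obtain ⟨w, hw, P, hP, hprime, hhom⟩ := hj.exists_weight hZ
  subst hP
  exact exists_algEquiv_mvPolynomial_quotient hw (Ideal.Quotient.mkₐ K (relations j m))
    (Ideal.Quotient.mkₐ_surjective K _) (vertex j m) (comap_mk_vertex j m)
    (PrimeSpectrum.vanishingIdeal Z) hhom hprime.ne_top hs

end Components

theorem exists_iso_affineSpace {K : Type u} [Field K] {B : Type u} [CommRing B] [Algebra K B]
    {d : ℕ} (φ : MvPolynomial (Fin d) K ≃ₐ[K] B) :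
    ∃ e : Spec (CommRingCat.of B) ≅
        AffineSpace (ULift.{u} (Fin d)) (Spec (CommRingCat.of K)),
      e.hom ≫ (AffineSpace (ULift.{u} (Fin d)) (Spec (CommRingCat.of K)) ↘
        Spec (CommRingCat.of K)) = Spec.map (CommRingCat.ofHom (algebraMap K B)) := by
  let ψ : MvPolynomial (ULift.{u} (Fin d)) K ≃ₐ[K] B :=
    (renameEquiv K Equiv.ulift).trans φ
  let i : CommRingCat.of (MvPolynomial (ULift.{u} (Fin d)) K) ≅ CommRingCat.of B :=
    ψ.toRingEquiv.toCommRingCatIso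
  refine ⟨Scheme.Spec.mapIso i.op ≪≫ (AffineSpace.SpecIso _ (.of K)).symm, ?_⟩
  rw [Iso.trans_hom, Iso.symm_hom, Category.assoc, AffineSpace.SpecIso_inv_over]
  change Spec.map i.hom ≫ _ = _
  rw [← Spec.map_comp]
  congr 1
  ext r
  exact ψ.commutes r

end Marked

open Marked in
theorem mainTheorem11 {K : Type u} [Field K] [Infinite K] {n : ℕ}
    (j : Ideal (MvPolynomial (Fin n) K)) (m : ℕ) (hj : IsAffineSegment j m) :
    (∀ Z ∈ irreducibleComponents (markedScheme j m), vertex j m ∈ Z) ∧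
      ConnectedSpace (markedScheme j m) ∧
      ∀ Z ∈ irreducibleComponents (markedScheme j m), IsSmoothAtVertex j m Z →
        ∃ (d : ℕ) (e : reducedSubscheme j m Z ≅
            AffineSpace (ULift.{u} (Fin d)) (Spec (CommRingCat.of K))),
          e.hom ≫ (AffineSpace (ULift.{u} (Fin d)) (Spec (CommRingCat.of K)) ↘
            Spec (CommRingCat.of K)) = structureMorphism j m Z := by
  refine ⟨fun Z hZ => hj.vertex_mem hZ, hj.connectedSpace, fun Z hZ hs => ?_⟩
  obtain ⟨d, ⟨φ⟩⟩ := hj.exists_algEquiv hZ hs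
  exact ⟨d, exists_iso_affineSpace φ⟩
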